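/- Let $n\ge 0$ be an integer and $\eta,\alpha\in\mathbb C$. Consider the $(4n+1)$-dimensional complex space with coordinates $A_0,\dots,A_{2n},B_1,\dots,B_n,C_1,\dots,C_n$, the algebra $R$ of polynomial functions on it, and the generating functions $$A(\lambda)=\alpha\lambda^{2n+1}+\sum_{i=0}^{2n}A_i\lambda^i,\qquad B(\lambda)=\lambda^{2n+1}+\sum_{i=1}^{n}B_i\lambda^{2i-1},\qquad C(\lambda)=\sum_{i=1}^{n}C_i\lambda^{2i-1},$$ $$T(\lambda)=\begin{pmatrix}A(\lambda)&B(\lambda)\\ C(\lambda)&A(-\lambda)\end{pmatrix}.$$ For $k=0,1$ let $\rho_k(\lambda)$ be the polynomial quotient of $\lambda^{2k-1}A(\lambda)$ by $B(\lambda)$ (equivalently, of $\lambda^{2k}A(\lambda)$ by the monic polynomial $\lambda B(\lambda)$). Then $\rho_0=0$ and $\rho_1(\lambda)=\alpha\lambda+A_{2n}$, and the following holds. (1) For each $k=0,1$ there is exactly one skew-symmetric $\mathbb C$-bilinear biderivation $\{\cdot,\cdot\}_k$ of $R$ such that for all $\lambda,\mu\in\mathbb C$ with $\lambda\ne\pm\mu$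 $$\{B(\lambda),B(\mu)\}_k=0,$$ $$\{A(\lambda),A(\mu)\}_k=\tfrac{\eta}{\lambda+\mu}\bigl(\mu^{2k}B(\lambda)C(\mu)-\lambda^{2k}B(\mu)C(\lambda)\bigr),$$ $$\{C(\lambda),C(\mu)\}_k=2\eta\bigl(\rho_k(-\mu)A(\mu)-\rho_k(\mu)A(-\mu)\bigr)C(\lambda)-2\eta\bigl(\rho_k(-\lambda)A(\lambda)-\rho_k(\lambda)A(-\lambda)\bigr)C(\mu),$$ $$\{A(\lambda),B(\mu)\}_k=\tfrac{\eta}{\lambda-\mu}\bigl(\lambda^{2k}A(\lambda)B(\mu)-\mu^{2k}A(\mu)B(\lambda)\bigr)+\tfrac{\eta}{\lambda+\mu}\bigl(\lambda^{2k}A(\lambda)B(\mu)+\mu^{2k}A(-\mu)B(\lambda)\bigr)-2\eta\rho_k(\lambda)B(\lambda)B(\mu),$$ $$\{A(\lambda),C(\mu)\}_k=-\tfrac{\eta}{\lambda-\mu}\bigl(\mu^{2k}A(\lambda)C(\mu)-\lambda^{2k}A(\mu)C(\lambda)\bigr)-2\eta k\lambda A(\lambda)C(\mu)-\tfrac{\eta}{\lambda+\mu}\bigl(\mu^{2k}A(\lambda)C(\mu)+\lambda^{2k}A(-\mu)C(\lambda)\bigr)+2\eta\rho_k(\lambda)B(\lambda)C(\mu),$$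 $$\{B(\lambda),C(\mu)\}_k=\tfrac{\eta\lambda^{2k}}{\lambda-\mu}\bigl(A(-\lambda)A(\mu)-A(\lambda)A(-\mu)\bigr)+\tfrac{\eta\lambda^{2k}}{\lambda+\mu}\bigl(A(\lambda)A(\mu)-A(-\lambda)A(-\mu)\bigr)+2\eta\bigl(\rho_k(\mu)A(-\mu)-\rho_k(-\mu)A(\mu)\bigr)B(\lambda).$$ (2) Both $\{\cdot,\cdot\}_0$ and $\{\cdot,\cdot\}_1$ are Poisson brackets, i.e. they satisfy the Jacobi identity. (3) $\{\cdot,\cdot\}_0$ is the bracket of the rational reflection equation algebra: it is the unique skew-symmetric $\mathbb C$-bilinear biderivation of $R$ such that for all $\lambda,\mu\in\mathbb C$ with $\lambda\neq\pm\mu$ $$\{T_1(\lambda),T_2(\mu)\}_0=[r(\lambda-\mu),T_1(\lambda)T_2(\mu)]+T_1(\lambda)r(\lambda+\mu)T_2(\mu)-T_2(\mu)r(\lambda+\mu)T_1(\lambda),$$ where $T_1(\lambda)=T(\lambda)\otimes I$, $T_2(\mu)=I\otimes T(\mu)$, $r(\lambda)=\frac{\eta}{\lambda}\Pi$, and $\Pi$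 is the permutation matrix of $\mathbb C^2\otimes\mathbb C^2$. (4) The two brackets are compatible: $c_0\{\cdot,\cdot\}_0+c_1\{\cdot,\cdot\}_1$ is a Poisson bracket for all $c_0,c_1\in\mathbb C$. -/

import Mathlib

noncomputable section

open Polynomial
open scoped Kronecker

/-! ### Poisson brackets on a commutative algebra -/

/-- A skew-symmetric bilinear bracket which is a derivation in its second
(hence, by skew-symmetry, in each) argument. -/
structure IsSkewBiderivation {R : Type*} [CommRing R] [Algebra ℂ R]
    (b : R →ₗ[ℂ] R →ₗ[ℂ] R) : Prop where
  skew : ∀ f g : R, b f g = -b g f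
  leibniz : ∀ f g h : R, b f (g * h) = b f g * h + g * b f h

/-- A Poisson bracket: a skew-symmetric biderivation satisfying the Jacobi identity. -/
structure IsPoissonBracket {R : Type*} [CommRing R] [Algebra ℂ R]
    (b : R →ₗ[ℂ] R →ₗ[ℂ] R) : Prop extends IsSkewBiderivation b where
  jacobi : ∀ f g h : R, b f (b g h) + b g (b h f) + b h (b f g) = 0

/-- Two brackets are compatible if every linear combination of them is a Poisson bracket. -/
def AreCompatible {R : Type*} [CommRing R] [Algebra ℂ R]
    (b b' : R →ₗ[ℂ] R →ₗ[ℂ] R) : Prop :=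
  ∀ c c' : ℂ, IsPoissonBracket (c • b + c' • b')

namespace ReflectionAlgebra

/-! ### The space of coefficients and the matrix `T` -/

/-- The coordinates on the `4n+1`-dimensional space of coefficients:
`A i` is `A_i` for `0 ≤ i ≤ 2n`, while `B i`, `C i` are `B_{i+1}`, `C_{i+1}` for `0 ≤ i < n`. -/
inductive Gen (n : ℕ) : Type
  | A (i : Fin (2 * n + 1)) : Gen n
  | B (i : Fin n) : Gen n
  | C (i : Fin n) : Gen n

/-- The algebra of polynomial functions on the space of coefficients. -/
abbrev Coeffs (n : ℕ) : Type := MvPolynomial (Gen n) ℂ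

/-- `A(λ) = α λ^(2n+1) + A_{2n} λ^(2n) + ⋯ + A_0`; the leading coefficient `α` is a number. -/
def polyA (n : ℕ) (α : ℂ) : (Coeffs n)[X] :=
  C (MvPolynomial.C α) * X ^ (2 * n + 1)
    + ∑ i : Fin (2 * n + 1), C (MvPolynomial.X (Gen.A i)) * X ^ (i : ℕ)

/-- `B(λ) = λ^(2n+1) + B_n λ^(2n-1) + ⋯ + B_1 λ`. -/
def polyB (n : ℕ) : (Coeffs n)[X] :=
  X ^ (2 * n + 1) + ∑ i : Fin n, C (MvPolynomial.X (Gen.B i)) * X ^ (2 * (i : ℕ) + 1)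

/-- `C(λ) = C_n λ^(2n-1) + ⋯ + C_1 λ`. -/
def polyC (n : ℕ) : (Coeffs n)[X] :=
  ∑ i : Fin n, C (MvPolynomial.X (Gen.C i)) * X ^ (2 * (i : ℕ) + 1)

/-- `ρ_k(λ)`, the polynomial quotient of `λ^(2k-1) A(λ)` by `B(λ)`. To avoid the negative
power at `k = 0` numerator and denominator are multiplied by `λ`; note that `λ B(λ)` is monic. -/
def polyRho (n : ℕ) (α : ℂ) (k : ℕ) : (Coeffs n)[X] :=
  (X ^ (2 * k) * polyA n α) /ₘ (X * polyB n)

/-- The value of a polynomial with coefficients in `Coeffs n` at a complex number. -/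
def at' {n : ℕ} (p : (Coeffs n)[X]) (x : ℂ) : Coeffs n :=
  p.eval (algebraMap ℂ (Coeffs n) x)

/-- The matrix `T(λ)` with rows `(A(λ), B(λ))` and `(C(λ), A(-λ))`. -/
def T (n : ℕ) (α x : ℂ) : Matrix (Fin 2) (Fin 2) (Coeffs n) :=
  !![at' (polyA n α) x, at' (polyB n) x;
     at' (polyC n) x, at' (polyA n α) (-x)]

/-! ### The brackets `{·,·}_k` -/

/-- The defining relations of `{·,·}_k` on the generating functions `A(λ)`, `B(λ)`, `C(λ)`.
The spectral parameters `λ`, `μ` are called `x`, `y`; they range over all complex numbers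
for which the denominators `λ ± μ` do not vanish. -/
structure SatisfiesFamilyRelations (n : ℕ) (η α : ℂ) (k : ℕ)
    (b : Coeffs n →ₗ[ℂ] Coeffs n →ₗ[ℂ] Coeffs n) : Prop where
  BB : ∀ x y : ℂ, x - y ≠ 0 → x + y ≠ 0 →
    b (at' (polyB n) x) (at' (polyB n) y) = 0
  AA : ∀ x y : ℂ, x - y ≠ 0 → x + y ≠ 0 →
    b (at' (polyA n α) x) (at' (polyA n α) y) =
      (η / (x + y)) •
        (y ^ (2 * k) • (at' (polyB n) x * at' (polyC n) y)
          - x ^ (2 * k) • (at' (polyB n) y * at' (polyC n) x))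
  CC : ∀ x y : ℂ, x - y ≠ 0 → x + y ≠ 0 →
    b (at' (polyC n) x) (at' (polyC n) y) =
      (2 * η) •
        ((at' (polyRho n α k) (-y) * at' (polyA n α) y
            - at' (polyRho n α k) y * at' (polyA n α) (-y)) * at' (polyC n) x)
      - (2 * η) •
        ((at' (polyRho n α k) (-x) * at' (polyA n α) x
            - at' (polyRho n α k) x * at' (polyA n α) (-x)) * at' (polyC n) y)
  AB : ∀ x y : ℂ, x - y ≠ 0 → x + y ≠ 0 →
    b (at' (polyA n α) x) (at' (polyB n) y) =
      (η / (x - y)) •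
        (x ^ (2 * k) • (at' (polyA n α) x * at' (polyB n) y)
          - y ^ (2 * k) • (at' (polyA n α) y * at' (polyB n) x))
      + (η / (x + y)) •
        (x ^ (2 * k) • (at' (polyA n α) x * at' (polyB n) y)
          + y ^ (2 * k) • (at' (polyA n α) (-y) * at' (polyB n) x))
      - (2 * η) • (at' (polyRho n α k) x * at' (polyB n) x * at' (polyB n) y)
  AC : ∀ x y : ℂ, x - y ≠ 0 → x + y ≠ 0 →
    b (at' (polyA n α) x) (at' (polyC n) y) =
      -((η / (x - y)) •
        (y ^ (2 * k) • (at' (polyA n α) x * at' (polyC n) y)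
          - x ^ (2 * k) • (at' (polyA n α) y * at' (polyC n) x)))
      - (2 * η * (k : ℂ) * x) • (at' (polyA n α) x * at' (polyC n) y)
      - (η / (x + y)) •
        (y ^ (2 * k) • (at' (polyA n α) x * at' (polyC n) y)
          + x ^ (2 * k) • (at' (polyA n α) (-y) * at' (polyC n) x))
      + (2 * η) • (at' (polyRho n α k) x * at' (polyB n) x * at' (polyC n) y)
  BC : ∀ x y : ℂ, x - y ≠ 0 → x + y ≠ 0 →
    b (at' (polyB n) x) (at' (polyC n) y) =
      (η * x ^ (2 * k) / (x - y)) •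
        (at' (polyA n α) (-x) * at' (polyA n α) y
          - at' (polyA n α) x * at' (polyA n α) (-y))
      + (η * x ^ (2 * k) / (x + y)) •
        (at' (polyA n α) x * at' (polyA n α) y
          - at' (polyA n α) (-x) * at' (polyA n α) (-y))
      + (2 * η) •
        ((at' (polyRho n α k) y * at' (polyA n α) (-y)
            - at' (polyRho n α k) (-y) * at' (polyA n α) y) * at' (polyB n) x)

/-! ### The rational reflection equation algebra -/

/-- The permutation matrix `Π` of the tensor square of the two-dimensional space. -/
def permMatrix (n : ℕ) : Matrix (Fin 2 × Fin 2) (Fin 2 × Fin 2) (Coeffs n) :=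
  Matrix.of fun p q => if p.1 = q.2 ∧ p.2 = q.1 then 1 else 0

/-- The rational `r`-matrix `r(λ) = (-η / λ) Π`. -/
def rMatrix (n : ℕ) (η x : ℂ) : Matrix (Fin 2 × Fin 2) (Fin 2 × Fin 2) (Coeffs n) :=
  (-η / x) • permMatrix n

/-- `T₁(λ) = T(λ) ⊗ I`. -/
def T₁ (n : ℕ) (α x : ℂ) : Matrix (Fin 2 × Fin 2) (Fin 2 × Fin 2) (Coeffs n) :=
  T n α x ⊗ₖ (1 : Matrix (Fin 2) (Fin 2) (Coeffs n))

/-- `T₂(μ) = I ⊗ T(μ)`. -/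
def T₂ (n : ℕ) (α y : ℂ) : Matrix (Fin 2 × Fin 2) (Fin 2 × Fin 2) (Coeffs n) :=
  (1 : Matrix (Fin 2) (Fin 2) (Coeffs n)) ⊗ₖ T n α y

/-- The `4 × 4` matrix `{T₁(λ), T₂(μ)}` of the brackets `{T_{ij}(λ), T_{kl}(μ)}`
(row index `(i, k)`, column index `(j, l)`). -/
def bracketMatrix (n : ℕ) (α : ℂ) (b : Coeffs n →ₗ[ℂ] Coeffs n →ₗ[ℂ] Coeffs n) (x y : ℂ) :
    Matrix (Fin 2 × Fin 2) (Fin 2 × Fin 2) (Coeffs n) :=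
  Matrix.of fun p q => b (T n α x p.1 q.1) (T n α y p.2 q.2)

/-- The relation
`{T₁(λ), T₂(μ)} = [r(λ-μ), T₁(λ) T₂(μ)] + T₁(λ) r(λ+μ) T₂(μ) - T₂(μ) r(λ+μ) T₁(λ)`
with `r(λ) = (-η / λ) Π`. -/
def SatisfiesReflectionEquation (n : ℕ) (η α : ℂ)
    (b : Coeffs n →ₗ[ℂ] Coeffs n →ₗ[ℂ] Coeffs n) : Prop :=
  ∀ x y : ℂ, x - y ≠ 0 → x + y ≠ 0 →
    bracketMatrix n α b x y =
      (rMatrix n η (x - y) * (T₁ n α x * T₂ n α y)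
        - (T₁ n α x * T₂ n α y) * rMatrix n η (x - y))
      + T₁ n α x * rMatrix n η (x + y) * T₂ n α y
      - T₂ n α y * rMatrix n η (x + y) * T₁ n α x

end ReflectionAlgebra

end

noncomputable section

open Polynomial
open scoped Kronecker

/-! ### Skew biderivations and their Jacobiators -/

section Jacobiator

variable {R : Type*} [CommRing R] [Algebra ℂ R] {b : R →ₗ[ℂ] R →ₗ[ℂ] R}

/-! In the variable `u = λ²` write `A(λ) = E(u) + λ O(u)` and divide `B(λ)`, `C(λ)` by `λ`. For the
resulting functions `E, O, B, C` the factors `λ^(2k)` turn into `c₀ + c₁ u`, with `(c₀, c₁) = (η,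
0)` for `k = 0` and `(0, η)` for `k = 1`. The relations (`PencilRelations`) are linear in `(c₀,
c₁)`, so a linear combination of the two brackets belongs to the same family. Hence the Jacobi
identity for arbitrary `(c₀, c₁)` proves that both brackets are Poisson and that they are
compatible.

Existence: the right-hand sides must be polynomials in `u`, `v` involving only coefficients that are
coordinates, since brackets with the constant leading coefficients vanish. They are built from the
Bezoutian `(p(u) q(v) - p(v) q(u)) / (u - v)`. The factor `c₀ + c₁ u` raises its degree in `u` by
one, and subtracting a multiple of the monic `B(u)` restores it; the terms with `ρ_1` come from this
correction (`exists_kernel`). The coefficients of the kernels then serve as structure constants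
(`exists_bracket_of_kernel`).

Jacobi: the Jacobiator is a derivation in each argument, so coordinates suffice, and these are
recovered from generating functions at pairwise distinct points (`map_X_gen_eq_zero`). There the
identity is rational and is checked for each triple of functions (`jacobiator_eq_zero_of_rank_le`).

Uniqueness: the relations fix the brackets of `E, O, B, C` at almost all points, hence those of the
coordinates (`eq_of_at'`). The reflection equation is verified entry by entry on the member `(η,
0)`. -/

theorem IsSkewBiderivation.map_algebraMap (hb : IsSkewBiderivation b) (f : R) (c : ℂ) :
    b f (algebraMap ℂ R c) = 0 := by
  have h : b f 1 = 0 := by simpa using hb.leibniz f 1 1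
  rw [Algebra.algebraMap_eq_smul_one, map_smul, h, smul_zero]

theorem IsSkewBiderivation.algebraMap_left (hb : IsSkewBiderivation b) (f : R) (c : ℂ) :
    b (algebraMap ℂ R c) f = 0 := by
  rw [hb.skew, hb.map_algebraMap, neg_zero]

theorem smul_add_smul_apply_apply (b b' : R →ₗ[ℂ] R →ₗ[ℂ] R) (c c' : ℂ) (f g : R) :
    (c • b + c' • b') f g = algebraMap ℂ R c * b f g + algebraMap ℂ R c' * b' f g := by
  simp only [LinearMap.add_apply, LinearMap.smul_apply]
  rw [Algebra.smul_def, Algebra.smul_def]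

theorem IsSkewBiderivation.smul_add_smul {b' : R →ₗ[ℂ] R →ₗ[ℂ] R} (hb : IsSkewBiderivation b)
    (hb' : IsSkewBiderivation b') (c c' : ℂ) : IsSkewBiderivation (c • b + c' • b') where
  skew f g := by
    rw [smul_add_smul_apply_apply, smul_add_smul_apply_apply, hb.skew f g, hb'.skew f g]
    ring
  leibniz f g h := by
    simp only [smul_add_smul_apply_apply, hb.leibniz f g h, hb'.leibniz f g h]
    ring

/-- A skew biderivation with a fixed first argument. -/
def IsSkewBiderivation.derivation (hb : IsSkewBiderivation b) (f : R) : Derivation ℂ R R :=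
  Derivation.mk' (b f) fun g h => by
    rw [hb.leibniz, smul_eq_mul, smul_eq_mul, mul_comm (b f g), add_comm]

/-- The cyclic sum whose vanishing is the Jacobi identity. -/
def jacobiator (b : R →ₗ[ℂ] R →ₗ[ℂ] R) (f g h : R) : R :=
  b f (b g h) + b g (b h f) + b h (b f g)

theorem jacobiator_rotate (f g h : R) : jacobiator b f g h = jacobiator b g h f := by
  unfold jacobiator
  abel

theorem IsSkewBiderivation.jacobiator_swap (hb : IsSkewBiderivation b) (f g h : R) :
    jacobiator b f g h = -jacobiator b g f h := by
  unfold jacobiator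
  rw [hb.skew f h, hb.skew h g, hb.skew g f]
  simp only [map_neg]
  abel

/-- The Jacobiator as a derivation in its last argument. -/
def IsSkewBiderivation.jacobiatorDerivation (hb : IsSkewBiderivation b) (f g : R) :
    Derivation ℂ R R :=
  Derivation.mk' (b f ∘ₗ b g + b g ∘ₗ b.flip f + b.flip (b f g)) fun h k => by
    simp only [LinearMap.add_apply, LinearMap.comp_apply, LinearMap.flip_apply, smul_eq_mul]
    rw [hb.skew (h * k) f, hb.skew (h * k) (b f g), hb.skew h f, hb.skew k f,
      hb.skew h (b f g), hb.skew k (b f g)]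
    simp only [hb.leibniz, map_neg, map_add]
    ring

end Jacobiator

namespace ReflectionAlgebra

/-! ### The pencil of brackets in the variable `u = λ²` -/

/-- The four generating functions in the variable `u = λ²`: the even and the odd part of `A`,
and the odd polynomials `B` and `C` divided by `λ`. -/
inductive Kind : Type
  | E
  | O
  | B
  | C

/-- An enumeration of the four generating functions. -/
def Kind.rank : Kind → ℕ
  | .E => 0
  | .O => 1
  | .B => 2
  | .C => 3

/-- The brackets of the generating functions `F .E`, `F .O`, `F .B`, `F .C` attached to the
linear polynomial `c₀ + c₁ u`. Here `a` is the leading coefficient of `F .E`, and `o`, `β`, `γ`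
are the subleading coefficients of `F .O`, `F .B`, `F .C`. -/
structure PencilRelations {R : Type*} [CommRing R] [Algebra ℂ R]
    (b : R →ₗ[ℂ] R →ₗ[ℂ] R) (α c₀ c₁ : ℂ) (F : Kind → ℂ → R) (a o β γ : R) : Prop where
  EE : ∀ u v, u ≠ v → b (F .E u) (F .E v) = 0
  OO : ∀ u v, u ≠ v → b (F .O u) (F .O v) = 0
  BB : ∀ u v, u ≠ v → b (F .B u) (F .B v) = 0
  EO : ∀ u v, u ≠ v → b (F .E u) (F .O v) = algebraMap ℂ R (u * (u - v)⁻¹) *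
    (algebraMap ℂ R (c₀ + c₁ * v) * F .B u * F .C v
      - algebraMap ℂ R (c₀ + c₁ * u) * F .B v * F .C u)
  EB : ∀ u v, u ≠ v → b (F .E u) (F .B v) = algebraMap ℂ R (2 * u * (u - v)⁻¹) *
    (algebraMap ℂ R (c₀ + c₁ * u) * F .O u * F .B v
      - algebraMap ℂ R (c₀ + c₁ * v) * F .O v * F .B u)
    - algebraMap ℂ R (2 * c₁ * α * u) * F .B u * F .B v
  OB : ∀ u v, u ≠ v → b (F .O u) (F .B v) = algebraMap ℂ R (2 * (u - v)⁻¹) *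
    (algebraMap ℂ R (c₀ + c₁ * u) * F .E u * F .B v
      - algebraMap ℂ R (c₀ + c₁ * v) * F .E v * F .B u)
    - algebraMap ℂ R (2 * c₁) * a * F .B u * F .B v
  EC : ∀ u v, u ≠ v → b (F .E u) (F .C v) =
    algebraMap ℂ R (2 * c₁ * α * u) * F .B u * F .C v
    - algebraMap ℂ R (2 * u * (c₀ + c₁ * u) * (u - v)⁻¹) * (F .O u * F .C v - F .O v * F .C u)
  OC : ∀ u v, u ≠ v → b (F .O u) (F .C v) =
    algebraMap ℂ R (2 * c₁) * a * F .B u * F .C v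
    - algebraMap ℂ R (2 * (c₀ + c₁ * u) * (u - v)⁻¹) * (F .E u * F .C v - F .E v * F .C u)
  BC : ∀ u v, u ≠ v → b (F .B u) (F .C v) =
    algebraMap ℂ R (4 * (c₀ + c₁ * u) * (u - v)⁻¹) * (F .E u * F .O v - F .E v * F .O u)
    + algebraMap ℂ R (4 * c₁) * (algebraMap ℂ R α * F .E v - a * F .O v) * F .B u
  CC : ∀ u v, u ≠ v → b (F .C u) (F .C v) =
    algebraMap ℂ R (4 * c₁) * ((algebraMap ℂ R α * F .E u - a * F .O u) * F .C v
      - (algebraMap ℂ R α * F .E v - a * F .O v) * F .C u)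
  -- Since `a` occurs on the right-hand sides above, iterated brackets involve its brackets too.
  -- They are the leading coefficients in `u` of the relations for `F .E u`.
  aE : ∀ v, b a (F .E v) = 0
  aO : ∀ v, b a (F .O v) =
    algebraMap ℂ R (c₀ + c₁ * v) * F .C v - algebraMap ℂ R c₁ * γ * F .B v
  aB : ∀ v, b a (F .B v) = algebraMap ℂ R 2 * (algebraMap ℂ R c₁ * (o * F .B v - β * F .O v)
    + algebraMap ℂ R (c₀ + c₁ * v) * (algebraMap ℂ R α * F .B v - F .O v)
    - algebraMap ℂ R c₁ * (algebraMap ℂ R α * F .B v - F .O v) * β)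
  aC : ∀ v, b a (F .C v) = -algebraMap ℂ R 2 * (algebraMap ℂ R c₁ * (o * F .C v - γ * F .O v)
    + algebraMap ℂ R (c₀ + c₁ * v) * (algebraMap ℂ R α * F .C v)
    - algebraMap ℂ R c₁ * (algebraMap ℂ R α * F .C v) * β)

namespace PencilRelations

variable {R : Type*} [CommRing R] [Algebra ℂ R] {b : R →ₗ[ℂ] R →ₗ[ℂ] R} {α c₀ c₁ : ℂ}
  {F : Kind → ℂ → R} {a o β γ : R}

theorem smul_add_smul {b' : R →ₗ[ℂ] R →ₗ[ℂ] R} {c₀' c₁' : ℂ}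
    (H : PencilRelations b α c₀ c₁ F a o β γ) (H' : PencilRelations b' α c₀' c₁' F a o β γ)
    (c c' : ℂ) : PencilRelations (c • b + c' • b') α (c * c₀ + c' * c₀') (c * c₁ + c' * c₁')
      F a o β γ := by
  constructor <;> intro u <;> try intro v h
  all_goals rw [smul_add_smul_apply_apply]
  · rw [H.EE u v h, H'.EE u v h]; ring
  · rw [H.OO u v h, H'.OO u v h]; ring
  · rw [H.BB u v h, H'.BB u v h]; ring
  · rw [H.EO u v h, H'.EO u v h]; simp only [map_add, map_mul]; ring
  · rw [H.EB u v h, H'.EB u v h]; simp only [map_add, map_mul]; ring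
  · rw [H.OB u v h, H'.OB u v h]; simp only [map_add, map_mul]; ring
  · rw [H.EC u v h, H'.EC u v h]; simp only [map_add, map_mul]; ring
  · rw [H.OC u v h, H'.OC u v h]; simp only [map_add, map_mul]; ring
  · rw [H.BC u v h, H'.BC u v h]; simp only [map_add, map_mul]; ring
  · rw [H.CC u v h, H'.CC u v h]; simp only [map_add, map_mul]; ring
  · rw [H.aE, H'.aE]; ring
  · rw [H.aO, H'.aO]; simp only [map_add, map_mul]; ring
  · rw [H.aB, H'.aB]; simp only [map_add, map_mul]; ring
  · rw [H.aC, H'.aC]; simp only [map_add, map_mul]; ring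

-- By symmetry only twenty of the sixty-four triples of kinds are needed. The relations and the
-- Leibniz rule express each Jacobiator through values of the generating functions, `a`, `o`, `β`,
-- `γ` and inverse differences, where it vanishes identically.
set_option maxHeartbeats 4000000 in
theorem jacobiator_eq_zero_of_rank_le (hb : IsSkewBiderivation b)
    (H : PencilRelations b α c₀ c₁ F a o β γ) {X Y Z : Kind} (hXY : X.rank ≤ Y.rank)
    (hYZ : Y.rank ≤ Z.rank) {u v w : ℂ} (huv : u ≠ v) (huw : u ≠ w) (hvw : v ≠ w) :
    jacobiator b (F X u) (F Y v) (F Z w) = 0 := by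
  have hvu := huv.symm
  have hwu := huw.symm
  have hwv := hvw.symm
  have ivu : (v - u)⁻¹ = -(u - v)⁻¹ := by rw [← inv_neg, neg_sub]
  have iwu : (w - u)⁻¹ = -(u - w)⁻¹ := by rw [← inv_neg, neg_sub]
  have iwv : (w - v)⁻¹ = -(v - w)⁻¹ := by rw [← inv_neg, neg_sub]
  have inv_mul (x y : ℂ) (h : x ≠ y) : algebraMap ℂ R (x - y)⁻¹ *
      (algebraMap ℂ R x - algebraMap ℂ R y) = 1 := by
    rw [← map_sub, ← map_mul, inv_mul_cancel₀ (sub_ne_zero.2 h), map_one]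
  have kuv := inv_mul u v huv
  have kuw := inv_mul u w huw
  have kvw := inv_mul v w hvw
  have map_two (f : R) : b f 2 = 0 := by
    rw [← map_ofNat (algebraMap ℂ R) 2, hb.map_algebraMap]
  have map_four (f : R) : b f 4 = 0 := by
    rw [← map_ofNat (algebraMap ℂ R) 4, hb.map_algebraMap]
  have skew (X Y : Kind) (x y : ℂ) : b (F X x) (F Y y) = -b (F Y y) (F X x) := hb.skew _ _
  have skew_left (X : Kind) (x : ℂ) : b (F X x) a = -b a (F X x) := hb.skew _ _
  -- The inverses become free variables tied only by `p (u - v) = 1` and its analogues, so the goals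
  -- are polynomial identities modulo these three equations.
  generalize hi : (u - v)⁻¹ = p at *
  generalize hj : (u - w)⁻¹ = q at *
  generalize hk : (v - w)⁻¹ = r at *
  cases X <;> cases Y <;> first | exact absurd hXY (by decide) | skip
  all_goals cases Z <;> first | exact absurd hYZ (by decide) | skip
  all_goals
    simp only [jacobiator, skew_left, skew .O .E, skew .B .E, skew .C .E, skew .B .O,
      skew .C .O, skew .C .B, H.EE, H.OO, H.BB, H.EO, H.EB, H.OB, H.EC, H.OC, H.BC, H.CC, H.aE,
      H.aO, H.aB, H.aC, ne_eq, huv, huw, hvw, hvu, hwu, hwv, not_false_eq_true, map_add, map_sub,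
      map_neg, hb.leibniz, hb.map_algebraMap, map_zero, map_mul, map_ofNat, map_two, map_four,
      zero_mul, mul_zero, neg_mul, mul_neg, zero_add, add_zero, sub_zero, neg_zero, hi, hj, hk,
      ivu, iwu, iwv]
    try grind

end PencilRelations

theorem PencilRelations.jacobiator_eq_zero {R : Type*} [CommRing R] [Algebra ℂ R]
    {b : R →ₗ[ℂ] R →ₗ[ℂ] R} {α c₀ c₁ : ℂ} {F : Kind → ℂ → R} {a o β γ : R}
    (hb : IsSkewBiderivation b) (H : PencilRelations b α c₀ c₁ F a o β γ) (X Y Z : Kind)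
    {u v w : ℂ} (huv : u ≠ v) (huw : u ≠ w) (hvw : v ≠ w) :
    jacobiator b (F X u) (F Y v) (F Z w) = 0 := by
  have key {X Y Z : Kind} {u v w : ℂ} (hXY : X.rank ≤ Y.rank) (hXZ : X.rank ≤ Z.rank)
      (huv : u ≠ v) (huw : u ≠ w) (hvw : v ≠ w) : jacobiator b (F X u) (F Y v) (F Z w) = 0 := by
    rcases le_total Y.rank Z.rank with h | h
    · exact H.jacobiator_eq_zero_of_rank_le hb hXY h huv huw hvw
    · rw [jacobiator_rotate, hb.jacobiator_swap, jacobiator_rotate, jacobiator_rotate,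
        H.jacobiator_eq_zero_of_rank_le hb hXZ h huw huv hvw.symm, neg_zero]
  by_cases hX : X.rank ≤ Y.rank ∧ X.rank ≤ Z.rank
  · exact key hX.1 hX.2 huv huw hvw
  by_cases hY : Y.rank ≤ Z.rank ∧ Y.rank ≤ X.rank
  · rw [jacobiator_rotate]
    exact key hY.1 hY.2 hvw huv.symm huw.symm
  · rw [jacobiator_rotate, jacobiator_rotate]
    exact key (by omega) (by omega) huw.symm hvw.symm huv

/-! ### The kernel of the brackets -/

section Kernel

variable {R : Type*} [CommRing R] {n : ℕ}

/-- The quotient of `p(u) q(v) - p(v) q(u)` by `u - v`. -/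
theorem exists_bezoutian {p q : R[X]} (hp : p.natDegree ≤ n) (hq : q.natDegree ≤ n) :
    ∃ H : R[X][X], (X - C X) * H = p.map C * C q - C p * q.map C ∧
      ∀ i j, n ≤ i ∨ n ≤ j → (H.coeff i).coeff j = 0 := by
  -- The outer variable is `u`, the inner one `v`; the numerator vanishes at `u = v`.
  obtain ⟨H, hH⟩ : (X - C X : R[X][X]) ∣ p.map C * C q - C p * q.map C := by
    rw [dvd_iff_isRoot]
    simp [eval_map, mul_comm]
  have hN (i) : (p.map C * C q - C p * q.map C : R[X][X]).coeff i
      = C (p.coeff i) * q - p * C (q.coeff i) := by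
    simp
  have h0 : -(X * H.coeff 0) = C (p.coeff 0) * q - p * C (q.coeff 0) := by
    rw [← hN, hH]; simp [sub_mul, mul_coeff_zero]
  have hs (i) : H.coeff i - X * H.coeff (i + 1)
      = C (p.coeff (i + 1)) * q - p * C (q.coeff (i + 1)) := by
    rw [← hN, hH]; simp [sub_mul, coeff_X_mul]
  refine ⟨H, hH.symm, ?_⟩
  have hj (i j) (h : n ≤ j) : (H.coeff i).coeff j = 0 := by
    have hp' (k) (hk : n < k) : p.coeff k = 0 := coeff_eq_zero_of_natDegree_lt (by omega)
    have hq' (k) (hk : n < k) : q.coeff k = 0 := coeff_eq_zero_of_natDegree_lt (by omega)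
    have hj' : n < j + 1 := by omega
    induction i generalizing j with
    | zero =>
      have := congrArg (fun r => coeff r (j + 1)) h0
      simpa [coeff_X_mul, hp' _ hj', hq' _ hj'] using this
    | succ i ih =>
      have := congrArg (fun r => coeff r (j + 1)) (hs i)
      simpa [coeff_X_mul, hp' _ hj', hq' _ hj',
        ih (j + 1) (by omega) (by omega)] using this
  -- Beyond degree `n` the recursion `hs` is homogeneous, so `H.coeff i` is a multiple of
  -- coefficients of arbitrarily high index, which vanish.
  have hi (k i) (h : n ≤ i) : H.coeff i = X ^ k * H.coeff (i + k) := by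
    induction k with
    | zero => simp
    | succ k ih =>
      have h1 := hs (i + k)
      rw [coeff_eq_zero_of_natDegree_lt (show p.natDegree < i + k + 1 by omega),
        coeff_eq_zero_of_natDegree_lt (show q.natDegree < i + k + 1 by omega)] at h1
      simp only [map_zero, zero_mul, mul_zero, sub_zero] at h1
      rw [ih, sub_eq_zero.1 h1, pow_succ, mul_assoc, add_assoc]
  rintro i j (h | h)
  · have h0 : H.coeff (i + (H.natDegree + 1)) = 0 := coeff_eq_zero_of_natDegree_lt (by omega)
    rw [hi (H.natDegree + 1) i h, h0, mul_zero, coeff_zero]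
  · exact hj i j h

/-- The kernel `(c₀ + c₁ u) (p(u) q(v) - p(v) q(u)) / (u - v) - c₁ (pₙ q(v) - qₙ p(v)) b(u)`
is a polynomial of degree less than `n` in `u` and in `v`; the last clause gives the leading
coefficient in `u`. -/
theorem exists_kernel (c₀ c₁ : R) {p q b : R[X]} (hp : p.natDegree ≤ n) (hq : q.natDegree ≤ n)
    (hb : b.natDegree ≤ n) (hb1 : b.coeff n = 1) :
    ∃ G : R[X][X], (∀ i j, n ≤ i ∨ n ≤ j → (G.coeff i).coeff j = 0) ∧
      (∀ U V, (U - V) * (G.eval (C U)).eval V =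
        (c₀ + c₁ * U) * (p.eval U * q.eval V - p.eval V * q.eval U)
          - (U - V) * (c₁ * (p.coeff n * q.eval V - q.coeff n * p.eval V) * b.eval U)) ∧
      ∀ V, ((X * G).coeff n).eval V =
        (c₀ + c₁ * V) * (p.coeff n * q.eval V - q.coeff n * p.eval V)
          + c₁ * ((X * p).coeff n * q.eval V - (X * q).coeff n * p.eval V)
          - c₁ * (p.coeff n * q.eval V - q.coeff n * p.eval V) * (X * b).coeff n := by
  obtain ⟨H, hH, hH0⟩ := exists_bezoutian hp hq
  set W : R[X] := C (p.coeff n) * q - C (q.coeff n) * p with hW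
  have hHn (i) (hi : n ≤ i) : H.coeff i = 0 := by
    ext j
    rw [hH0 i j (Or.inl hi), coeff_zero]
  have hXHn : (X * H).coeff n = W := by
    have h := congrArg (fun r => coeff r n) hH
    rw [hW, mul_comm (C (q.coeff n))]
    simpa [sub_mul, hHn n le_rfl] using h
  refine ⟨(C (C c₀) + C (C c₁) * X) * H - C (C c₁ * W) * b.map C, ?_, ?_, ?_⟩
  -- The terms of degree `n` in `W` cancel, so the correction keeps the degree in `v` below `n`.
  · have hWn : ∀ j, n ≤ j → W.coeff j = 0 := by
      intro j hj
      rcases hj.eq_or_lt with rfl | hj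
      · simp [hW, mul_comm]
      · have hp' : p.coeff j = 0 := coeff_eq_zero_of_natDegree_lt (by omega)
        have hq' : q.coeff j = 0 := coeff_eq_zero_of_natDegree_lt (by omega)
        simp [hW, hp', hq']
    have hcoeff (i) : ((C (C c₀) + C (C c₁) * X) * H - C (C c₁ * W) * b.map C : R[X][X]).coeff i
        = C c₀ * H.coeff i + C c₁ * (X * H).coeff i - C c₁ * W * C (b.coeff i) := by
      simp only [add_mul, mul_assoc, coeff_sub, coeff_add, coeff_C_mul, coeff_map]
    rintro i j (h | h)
    · rw [hcoeff, hHn i h]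
      rcases h.eq_or_lt with rfl | h
      -- In degree `n` in `u`, the overflow `c₁ W` of `c₁ u H` cancels against `c₁ W b` because `b`
      -- has leading coefficient 1.
      · rw [hXHn, hb1]
        simp
      · obtain ⟨k, rfl⟩ : ∃ k, i = k + 1 := ⟨i - 1, by omega⟩
        rw [coeff_X_mul, hHn k (by omega),
          coeff_eq_zero_of_natDegree_lt (by omega : b.natDegree < k + 1)]
        simp
    · rw [hcoeff]
      have hXH : ((X * H).coeff i).coeff j = 0 := by
        cases i with
        | zero => simp
        | succ i => rw [coeff_X_mul, hH0 i j (Or.inr h)]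
      rw [coeff_sub, coeff_add, mul_assoc, coeff_C_mul, coeff_C_mul, coeff_C_mul, coeff_mul_C,
        hXH, hH0 i j (Or.inr h), hWn j h]
      simp
  · intro U V
    have h := congrArg (fun r => (r.eval (C U)).eval V) hH
    simp only [eval_mul, eval_sub, eval_X, eval_C, eval_map, eval₂_hom] at h
    simp only [hW, eval_mul, eval_sub, eval_add, eval_X, eval_C, eval_map, eval₂_hom]
    linear_combination (c₀ + c₁ * U) * h
  · intro V
    -- Obtained from `u² H = v (u H) + u (u - v) H`, where the last term is `u` times the numerator.
    have hXXH : (X * (X * H)).coeff n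
        = X * W + (C ((X * p).coeff n) * q - p * C ((X * q).coeff n)) := by
      have : X * (X * H) = C X * (X * H) + ((X * p).map C * C q - C p * (X * q).map C) := by
        simp only [Polynomial.map_mul, map_X]
        linear_combination X * hH
      rw [this, coeff_add, coeff_C_mul, hXHn, coeff_sub, coeff_mul_C, coeff_C_mul, coeff_map,
        coeff_map]
    have hXG : X * ((C (C c₀) + C (C c₁) * X) * H - C (C c₁ * W) * b.map C)
        = C (C c₀) * (X * H) + C (C c₁) * (X * (X * H)) - C (C c₁ * W) * (X * b).map C := by
      simp only [Polynomial.map_mul, map_X]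
      ring
    rw [hXG, coeff_sub, coeff_add, coeff_C_mul, coeff_C_mul, coeff_C_mul, coeff_map, hXHn, hXXH]
    simp only [hW, eval_mul, eval_sub, eval_add, eval_X, eval_C]
    ring

end Kernel

/-! ### Brackets from structure constants -/

/-- The skew biderivation with prescribed values on pairs of coordinates. -/
theorem exists_skewBiderivation {σ : Type*} [Finite σ] (π : σ → σ → MvPolynomial σ ℂ)
    (hπ : ∀ s t, π s t = -π t s) :
    ∃ b : MvPolynomial σ ℂ →ₗ[ℂ] MvPolynomial σ ℂ →ₗ[ℂ] MvPolynomial σ ℂ,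
      IsSkewBiderivation b ∧ ∀ s t, b (.X s) (.X t) = π s t := by
  classical
  have := Fintype.ofFinite σ
  refine ⟨LinearMap.mk₂ ℂ
    (fun f g => ∑ s, ∑ t, π s t * MvPolynomial.pderiv s f * MvPolynomial.pderiv t g) ?_ ?_ ?_ ?_,
    ⟨?_, ?_⟩, ?_⟩
  · intro f f' g
    simp only [map_add, mul_add, add_mul, Finset.sum_add_distrib]
  · intro c f g
    simp only [Derivation.map_smul, mul_smul_comm, smul_mul_assoc, Finset.smul_sum]
  · intro f g g'
    simp only [map_add, mul_add, Finset.sum_add_distrib]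
  · intro c f g
    simp only [Derivation.map_smul, mul_smul_comm, Finset.smul_sum]
  · intro f g
    simp only [LinearMap.mk₂_apply]
    rw [Finset.sum_comm, ← Finset.sum_neg_distrib]
    refine Finset.sum_congr rfl fun s _ => ?_
    rw [← Finset.sum_neg_distrib]
    refine Finset.sum_congr rfl fun t _ => ?_
    rw [hπ t s]
    ring
  · intro f g h
    simp only [LinearMap.mk₂_apply, Derivation.leibniz, smul_eq_mul, Finset.sum_mul,
      Finset.mul_sum, ← Finset.sum_add_distrib]
    refine Finset.sum_congr rfl fun s _ => Finset.sum_congr rfl fun t _ => ?_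
    ring
  · intro s t
    simp [LinearMap.mk₂_apply, MvPolynomial.pderiv_X, Pi.single_apply]

/-! ### Coordinates as coefficients of the four generating functions -/

variable {n : ℕ} {α : ℂ}

instance : Finite (Gen n) :=
  Finite.of_surjective
    (fun s : Fin (2 * n + 1) ⊕ Fin n ⊕ Fin n => s.elim Gen.A (Sum.elim Gen.B Gen.C)) <| by
    rintro (i | i | i)
    · exact ⟨.inl i, rfl⟩
    · exact ⟨.inr (.inl i), rfl⟩
    · exact ⟨.inr (.inr i), rfl⟩

/-- The number of coordinates among the coefficients of a generating function. -/
def Kind.size (n : ℕ) : Kind → ℕ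
  | .E => n + 1
  | _ => n

theorem Kind.size_le (n : ℕ) (X : Kind) : X.size n ≤ n + 1 := by
  cases X <;> simp [Kind.size]

/-- The coordinate which is the coefficient with index `i` of a generating function. -/
def Kind.gen : (X : Kind) → Fin (X.size n) → Gen n
  | .E, i => .A ⟨2 * i, by have := i.2; simp only [Kind.size] at this; omega⟩
  | .O, i => .A ⟨2 * i + 1, by have := i.2; simp only [Kind.size] at this; omega⟩
  | .B, i => .B i
  | .C, i => .C i

/-- The generating function in which a coordinate occurs. -/
def Gen.kind : Gen n → Kind
  | .A i => if (i : ℕ) % 2 = 0 then .E else .O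
  | .B _ => .B
  | .C _ => .C

/-- The index of a coordinate as a coefficient of its generating function. -/
def Gen.index : Gen n → ℕ
  | .A i => i / 2
  | .B i => i
  | .C i => i

theorem kind_gen (X : Kind) (i : Fin (X.size n)) : (X.gen i).kind = X := by
  cases X <;> simp [Kind.gen, Gen.kind]

theorem index_gen (X : Kind) (i : Fin (X.size n)) : (X.gen i).index = i := by
  cases X
  case O => simp [Kind.gen, Gen.index]; omega
  all_goals simp [Kind.gen, Gen.index]

theorem exists_gen (s : Gen n) : ∃ (X : Kind) (i : Fin (X.size n)), X.gen i = s := by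
  rcases s with i | i | i
  · rcases Nat.even_or_odd' (i : ℕ) with ⟨j, hj | hj⟩
    · exact ⟨.E, ⟨j, by simp only [Kind.size]; omega⟩, by simp [Kind.gen, ← hj]⟩
    · exact ⟨.O, ⟨j, by simp only [Kind.size]; omega⟩, by simp [Kind.gen, ← hj]⟩
  · exact ⟨.B, i, rfl⟩
  · exact ⟨.C, i, rfl⟩

/-- The leading coefficient of a generating function, where it is a number. -/
def Kind.top (α : ℂ) : Kind → ℂ
  -- This value is never read: the leading coefficient of `E` is the coordinate `A_{2n}`.
  | .E => 0
  | .O => α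
  | .B => 1
  | .C => 0

/-- The coefficients of the generating functions. -/
def coord (n : ℕ) (α : ℂ) (X : Kind) (i : ℕ) : Coeffs n :=
  if h : i < X.size n then MvPolynomial.X (X.gen ⟨i, h⟩)
  else if i = n then algebraMap ℂ _ (X.top α) else 0

/-- The generating functions as polynomials in `u = λ²`. -/
def genPoly (n : ℕ) (α : ℂ) (X : Kind) : (Coeffs n)[X] :=
  ∑ i ∈ Finset.range (n + 1), monomial i (coord n α X i)

/-- The values of the generating functions. -/
def genFun (n : ℕ) (α : ℂ) (X : Kind) (u : ℂ) : Coeffs n :=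
  (genPoly n α X).eval (algebraMap ℂ _ u)

theorem coeff_genPoly (X : Kind) {i : ℕ} (hi : i ≤ n) :
    (genPoly n α X).coeff i = coord n α X i := by
  simp [genPoly, coeff_monomial, Nat.lt_succ_of_le hi]

theorem natDegree_genPoly_le (X : Kind) : (genPoly n α X).natDegree ≤ n :=
  natDegree_sum_le_of_forall_le _ _ fun _ hi =>
    (natDegree_monomial_le _).trans (Nat.lt_succ_iff.1 (Finset.mem_range.1 hi))

theorem coeff_genPoly_top {X : Kind} (hX : X ≠ .E) :
    (genPoly n α X).coeff n = algebraMap ℂ _ (X.top α) := by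
  rw [coeff_genPoly X le_rfl, coord, dif_neg, if_pos rfl]
  cases X <;> simp_all [Kind.size]

theorem genFun_eq_sum (X : Kind) (u : ℂ) :
    genFun n α X u = ∑ i ∈ Finset.range (n + 1), u ^ i • coord n α X i := by
  simp only [genFun, genPoly, eval_finsetSum, eval_monomial, Algebra.smul_def, map_pow, mul_comm]

/-- The sum of a polynomial in two variables over its coefficients. -/
theorem sum_coeff_coeff {R : Type*} [CommRing R] {K : R[X][X]}
    (hK : ∀ i j, n < i ∨ n < j → (K.coeff i).coeff j = 0) (U V : R) :
    ∑ i ∈ Finset.range (n + 1), ∑ j ∈ Finset.range (n + 1), U ^ i * (V ^ j * (K.coeff i).coeff j)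
      = (K.eval (C U)).eval V := by
  have h1 : K.natDegree < n + 1 := by
    rw [Nat.lt_succ_iff, natDegree_le_iff_coeff_eq_zero]
    exact fun i hi => Polynomial.ext fun j => hK i j (Or.inl hi)
  have h2 (i) : (K.coeff i).natDegree < n + 1 := by
    rw [Nat.lt_succ_iff, natDegree_le_iff_coeff_eq_zero]
    exact fun j hj => hK i j (Or.inr hj)
  rw [eval_eq_sum_range' h1, eval_finsetSum]
  refine Finset.sum_congr rfl fun i _ => ?_
  rw [eval_mul, eval_pow, eval_C, eval_eq_sum_range' (h2 i), Finset.sum_mul]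
  refine Finset.sum_congr rfl fun j _ => ?_
  ring

/-- The skew biderivation whose brackets of the generating functions are given by a family of
polynomials in two variables. -/
theorem exists_bracket_of_kernel (K : Kind → Kind → (Coeffs n)[X][X])
    (hK : ∀ X Y i j, X.size n ≤ i ∨ Y.size n ≤ j → ((K X Y).coeff i).coeff j = 0) :
    ∃ b : Coeffs n →ₗ[ℂ] Coeffs n →ₗ[ℂ] Coeffs n, IsSkewBiderivation b ∧
      (∀ X Y u v, b (genFun n α X u) (genFun n α Y v) =
        ((K X Y).eval (C (algebraMap ℂ _ u))).eval (algebraMap ℂ _ v)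
          - ((K Y X).eval (C (algebraMap ℂ _ v))).eval (algebraMap ℂ _ u)) ∧
      ∀ X Y v, K Y X = 0 → b (coord n α X n) (genFun n α Y v) =
        ((K X Y).coeff n).eval (algebraMap ℂ _ v) := by
  obtain ⟨b, hb, hgen⟩ := exists_skewBiderivation (σ := Gen n)
    (fun s t => ((K s.kind t.kind).coeff s.index).coeff t.index
      - ((K t.kind s.kind).coeff t.index).coeff s.index) (fun s t => by ring)
  -- For an index that is not a coordinate both sides vanish: the left because `coord` is a
  -- constant, the right by the degree bounds `hK`.
  have hcoord (X Y : Kind) (i j : ℕ) : b (coord n α X i) (coord n α Y j) =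
      ((K X Y).coeff i).coeff j - ((K Y X).coeff j).coeff i := by
    by_cases hi : i < X.size n
    · by_cases hj : j < Y.size n
      · rw [coord, coord, dif_pos hi, dif_pos hj, hgen]
        simp only [kind_gen, index_gen]
      · rw [hK X Y i j (Or.inr (not_lt.1 hj)), hK Y X j i (Or.inl (not_lt.1 hj)), sub_zero,
          coord.eq_def n α Y j, dif_neg hj]
        split_ifs
        · exact hb.map_algebraMap _ _
        · exact map_zero _
    · rw [hK X Y i j (Or.inl (not_lt.1 hi)), hK Y X j i (Or.inr (not_lt.1 hi)), sub_zero,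
        coord.eq_def n α X i, dif_neg hi]
      split_ifs
      · exact hb.algebraMap_left _ _
      · rw [map_zero, LinearMap.zero_apply]
  have hK' (X Y : Kind) (i j) (h : n < i ∨ n < j) : ((K X Y).coeff i).coeff j = 0 := by
    have := X.size_le n
    have := Y.size_le n
    exact hK X Y i j (by omega)
  refine ⟨b, hb, fun X Y u v => ?_, fun X Y v h => ?_⟩
  · rw [← sum_coeff_coeff (hK' X Y), ← sum_coeff_coeff (hK' Y X), Finset.sum_comm
      (f := fun i j => algebraMap ℂ (Coeffs n) v ^ i * _), ← Finset.sum_sub_distrib,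
      genFun_eq_sum, genFun_eq_sum]
    simp only [map_sum, LinearMap.sum_apply, map_smul, LinearMap.smul_apply, hcoord, Finset.smul_sum]
    rw [Finset.sum_comm]
    simp only [← Finset.sum_sub_distrib]
    refine Finset.sum_congr rfl fun i _ => Finset.sum_congr rfl fun j _ => ?_
    simp only [Algebra.smul_def, map_pow]
    ring
  · rw [genFun_eq_sum, eval_eq_sum_range' (n := n + 1)]
    · simp only [map_sum, map_smul, hcoord, h, coeff_zero, sub_zero]
      simp only [Algebra.smul_def, map_pow, mul_comm]
    · rw [Nat.lt_succ_iff, natDegree_le_iff_coeff_eq_zero]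
      exact fun j hj => hK' X Y n j (Or.inr hj)

/-- The pencil relations for the generating functions of `Coeffs n`. -/
abbrev IsPencilBracket (n : ℕ) (α c₀ c₁ : ℂ) (b : Coeffs n →ₗ[ℂ] Coeffs n →ₗ[ℂ] Coeffs n) : Prop :=
  PencilRelations b α c₀ c₁ (genFun n α) (coord n α .E n) ((X * genPoly n α .O).coeff n)
    ((X * genPoly n α .B).coeff n) ((X * genPoly n α .C).coeff n)

theorem exists_isPencilBracket (n : ℕ) (α c₀ c₁ : ℂ) :
    ∃ b : Coeffs n →ₗ[ℂ] Coeffs n →ₗ[ℂ] Coeffs n,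
      IsSkewBiderivation b ∧ IsPencilBracket n α c₀ c₁ b := by
  let ι := algebraMap ℂ (Coeffs n)
  choose G hG hGe hGn using fun X Y : Kind => exists_kernel (ι c₀) (ι c₁)
    (natDegree_genPoly_le (n := n) (α := α) X) (natDegree_genPoly_le (n := n) (α := α) Y)
    (natDegree_genPoly_le (n := n) (α := α) .B)
    (by rw [coeff_genPoly_top (by simp), Kind.top, map_one])
  let W : (Coeffs n)[X] := C (ι α) * genPoly n α .E - C (coord n α .E n) * genPoly n α .O
  -- Only one order of each mixed pair is listed, because the bracket antisymmetrises `K`. For the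
  -- same reason `C, C` carries just one of the two terms of its relation.
  let K : Kind → Kind → (Coeffs n)[X][X]
    | .E, .O => -(X * G .C .B)
    | .E, .B => C (C 2) * (X * G .O .B)
    | .O, .B => C (C 2) * G .E .B
    | .E, .C => -(C (C 2) * (X * G .O .C))
    | .O, .C => -(C (C 2) * G .E .C)
    | .B, .C => C (C 4) * G .E .O
    | .C, .C => C (C (ι (4 * c₁))) * (W.map C * C (genPoly n α .C))
    | _, _ => 0
  -- The extra factor `u` raises the degree in `u` to at most `n`; this is admissible for `E`, which
  -- has `n + 1` coordinates.
  have hX (X Y : Kind) (i j : ℕ) (h : n + 1 ≤ i ∨ n ≤ j) :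
      ((Polynomial.X * G X Y).coeff i).coeff j = 0 := by
    cases i with
    | zero => simp
    | succ i => rw [coeff_X_mul]; exact hG X Y i j (by omega)
  have hW (i : ℕ) (h : n ≤ i) : W.coeff i = 0 := by
    rcases h.eq_or_lt with rfl | h
    · simp only [W, coeff_sub, coeff_C_mul, coeff_genPoly_top (show Kind.O ≠ .E by simp),
        coeff_genPoly .E le_rfl, Kind.top, ι]
      ring
    · simp only [W, coeff_sub, coeff_C_mul,
        coeff_eq_zero_of_natDegree_lt ((natDegree_genPoly_le _).trans_lt h)]
      ring
  have hC (j : ℕ) (h : n ≤ j) : (genPoly n α .C).coeff j = 0 := by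
    rcases h.eq_or_lt with rfl | h
    · rw [coeff_genPoly_top (by simp), Kind.top, map_zero]
    · exact coeff_eq_zero_of_natDegree_lt ((natDegree_genPoly_le _).trans_lt h)
  have hK (X Y : Kind) (i j : ℕ) (h : X.size n ≤ i ∨ Y.size n ≤ j) :
      ((K X Y).coeff i).coeff j = 0 := by
    cases X <;> cases Y <;> simp only [Kind.size] at h <;>
      simp only [K, coeff_neg, coeff_C_mul, coeff_mul_C, coeff_map, coeff_zero]
    case C.C => rcases h with h | h <;> simp [hW, hC, h]
    all_goals first | rw [hX _ _ _ _ (by omega)] | rw [hG _ _ _ _ (by omega)]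
    all_goals simp
  obtain ⟨b, hb, hbF, hba⟩ := exists_bracket_of_kernel (n := n) (α := α) K hK
  refine ⟨b, hb, ?_⟩
  have inv_mul (x y : ℂ) (h : x ≠ y) : ι (x - y)⁻¹ * (ι x - ι y) = 1 := by
    rw [← map_sub, ← map_mul, inv_mul_cancel₀ (sub_ne_zero.2 h), map_one]
  have htop (X : Kind) (hX : X ≠ .E) := coeff_genPoly_top (n := n) (α := α) hX
  have hE := coeff_genPoly (n := n) (α := α) .E le_rfl
  have hGuv (X Y : Kind) (u v : ℂ) (h : u ≠ v) :
      ((G X Y).eval (C (ι u))).eval (ι v) = ι (u - v)⁻¹ * ((ι c₀ + ι c₁ * ι u) *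
        (genFun n α X u * genFun n α Y v - genFun n α X v * genFun n α Y u))
        - ι c₁ * ((genPoly n α X).coeff n * genFun n α Y v
          - (genPoly n α Y).coeff n * genFun n α X v) * genFun n α .B u := by
    have h1 := hGe X Y (ι u) (ι v)
    have h2 := inv_mul u v h
    simp only [genFun]
    change _ = ι (u - v)⁻¹ * ((ι c₀ + ι c₁ * ι u) * (eval (ι u) _ * eval (ι v) _
      - eval (ι v) _ * eval (ι u) _)) - ι c₁ * (_ * eval (ι v) _ - _ * eval (ι v) _) * eval (ι u) _
    linear_combination ι (u - v)⁻¹ * h1 - (((G X Y).eval (C (ι u))).eval (ι v) +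
      ι c₁ * ((genPoly n α X).coeff n * (genPoly n α Y).eval (ι v)
          - (genPoly n α Y).coeff n * (genPoly n α X).eval (ι v)) * (genPoly n α .B).eval (ι u)) * h2
  have hW' (u : ℂ) : W.eval (ι u)
      = ι α * genFun n α .E u - coord n α .E n * genFun n α .O u := by
    simp [W, genFun, ι]
  have hCu (u : ℂ) : (genPoly n α .C).eval (ι u) = genFun n α .C u := rfl
  constructor
  case EE | OO | BB => intro u v h; rw [hbF]; simp [K]
  case aE => intro v; rw [hba _ _ _ rfl]; simp [K]
  case aO | aB | aC =>
    intro v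
    rw [hba _ _ _ rfl]
    simp only [K, coeff_neg, coeff_C_mul, eval_neg, eval_mul, eval_C]
    rw [hGn]
    simp only [htop _ (show Kind.O ≠ .E by simp), htop _ (show Kind.B ≠ .E by simp),
      htop _ (show Kind.C ≠ .E by simp), Kind.top, map_one, map_zero, map_add, map_mul, genFun,
      ι, map_ofNat]
    ring
  all_goals
    intro u v h
    have h1 := inv_mul u v h
    rw [hbF]
    simp only [K, eval_neg, eval_mul, eval_C, eval_X, eval_zero]
  case CC =>
    simp only [eval_map, eval₂_hom]
    erw [hW' u, hW' v, hCu u, hCu v]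
    simp only [eval_C, ι]
    ring
  all_goals
    erw [hGuv _ _ _ _ h]
    simp only [htop _ (show Kind.O ≠ .E by simp), htop _ (show Kind.B ≠ .E by simp),
      htop _ (show Kind.C ≠ .E by simp), hE, Kind.top, map_one, map_zero, map_add, map_mul, ι,
      map_ofNat] at h1 ⊢
    grind

/-! ### Reading off coefficients of generating functions -/

/-- Applying `L` to the coefficients gives a polynomial with infinitely many roots. The finite set
`S` absorbs the excluded points, such as `u = v`. -/
theorem map_X_gen_eq_zero (L : Coeffs n →ₗ[ℂ] Coeffs n) (X : Kind) {S : Set ℂ} (hS : S.Finite)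
    (h : ∀ u ∉ S, L (genFun n α X u) = 0) (i : Fin (X.size n)) :
    L (MvPolynomial.X (X.gen i)) = 0 := by
  let p : (Coeffs n)[X] := ∑ i ∈ Finset.range (n + 1), monomial i (L (coord n α X i))
  have hp : p = 0 := by
    refine eq_zero_of_infinite_isRoot p ?_
    refine (hS.infinite_compl.image
      (FaithfulSMul.algebraMap_injective ℂ (Coeffs n)).injOn).mono ?_
    rintro _ ⟨u, hu, rfl⟩
    have := h u hu
    rw [genFun_eq_sum] at this
    simp only [map_sum, map_smul] at this
    simp only [Set.mem_ofPred_eq, IsRoot.def, p, eval_finsetSum, eval_monomial, ← this]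
    simp only [Algebra.smul_def, map_pow, mul_comm]
  have hi : (i : ℕ) < n + 1 := i.2.trans_le (X.size_le n)
  have := congrArg (fun q => coeff q i) hp
  simpa [p, coeff_monomial, hi, coord] using this

theorem IsSkewBiderivation.eq_zero_of_X {b : Coeffs n →ₗ[ℂ] Coeffs n →ₗ[ℂ] Coeffs n}
    (hb : IsSkewBiderivation b)
    (h : ∀ s t, b (MvPolynomial.X s) (MvPolynomial.X t) = 0) : b = 0 := by
  have h1 (s : Gen n) (f : Coeffs n) : b (MvPolynomial.X s) f = 0 := by
    have : hb.derivation (MvPolynomial.X s) = 0 := MvPolynomial.derivation_ext fun t => h s t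
    exact congrArg (fun D : Derivation ℂ (Coeffs n) (Coeffs n) => D f) this
  refine LinearMap.ext fun f => ?_
  have : hb.derivation f = 0 := MvPolynomial.derivation_ext fun t => by
    change b f _ = 0
    rw [hb.skew, h1, neg_zero]
  refine LinearMap.ext fun g => ?_
  exact congrArg (fun D : Derivation ℂ (Coeffs n) (Coeffs n) => D g) this

theorem IsSkewBiderivation.eq_zero_of_genFun {b : Coeffs n →ₗ[ℂ] Coeffs n →ₗ[ℂ] Coeffs n}
    (hb : IsSkewBiderivation b) {S : Set ℂ} (hS : S.Finite)
    (h : ∀ X Y u v, u ∉ S → v ∉ S → u ≠ v → b (genFun n α X u) (genFun n α Y v) = 0) : b = 0 := by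
  refine IsSkewBiderivation.eq_zero_of_X hb fun s t => ?_
  obtain ⟨X, i, rfl⟩ := exists_gen s
  obtain ⟨Y, j, rfl⟩ := exists_gen t
  refine map_X_gen_eq_zero (α := α) (b (.X (X.gen i))) Y hS (fun v hv => ?_) j
  refine map_X_gen_eq_zero (α := α) (b.flip (genFun n α Y v)) X (hS.insert v) (fun u hu => ?_) i
  rw [Set.mem_insert_iff, not_or] at hu
  exact h X Y u v hu.2 hv hu.1

/-! ### The Jacobi identity on the whole algebra -/

theorem PencilRelations.isPoissonBracket {b : Coeffs n →ₗ[ℂ] Coeffs n →ₗ[ℂ] Coeffs n} {c₀ c₁ : ℂ}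
    (hb : IsSkewBiderivation b) (H : IsPencilBracket n α c₀ c₁ b) : IsPoissonBracket b := by
  refine ⟨hb, fun f g h => ?_⟩
  change jacobiator b f g h = 0
  -- Generating functions are replaced by coordinates one slot at a time, always the last one after
  -- rotation; the excluded points shrink from `{v, w}` to `{w}` to none.
  have h1 (X Y Z : Kind) (v w : ℂ) (hvw : v ≠ w) (i) :
      jacobiator b (genFun n α Y v) (genFun n α Z w) (.X (X.gen i)) = 0 := by
    refine map_X_gen_eq_zero (α := α) (hb.jacobiatorDerivation _ _ : Coeffs n →ₗ[ℂ] Coeffs n) X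
      (S := {v, w}) (by simp) (fun u hu => ?_) i
    simp only [Set.mem_insert_iff, Set.mem_singleton_iff, not_or] at hu
    exact H.jacobiator_eq_zero hb Y Z X hvw (Ne.symm hu.1) (Ne.symm hu.2)
  have h2 (X Y Z : Kind) (w : ℂ) (i j) :
      jacobiator b (genFun n α Z w) (.X (X.gen i)) (.X (Y.gen j)) = 0 := by
    refine map_X_gen_eq_zero (α := α) (hb.jacobiatorDerivation _ _ : Coeffs n →ₗ[ℂ] Coeffs n) Y
      (S := {w}) (by simp) (fun v hv => ?_) j
    change jacobiator b _ _ _ = 0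
    rw [jacobiator_rotate, jacobiator_rotate]
    exact h1 X Y Z v w (by simpa using hv) i
  have h3 (r s t : Gen n) : jacobiator b (.X r) (.X s) (.X t) = 0 := by
    obtain ⟨X, i, rfl⟩ := exists_gen r
    obtain ⟨Y, j, rfl⟩ := exists_gen s
    obtain ⟨Z, k, rfl⟩ := exists_gen t
    refine map_X_gen_eq_zero (α := α) (hb.jacobiatorDerivation _ _ : Coeffs n →ₗ[ℂ] Coeffs n) Z
      (S := ∅) (by simp) (fun w _ => ?_) k
    change jacobiator b _ _ _ = 0
    rw [jacobiator_rotate, jacobiator_rotate]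
    exact h2 X Y Z w i j
  have ext (f g : Coeffs n) (h : ∀ t, jacobiator b f g (.X t) = 0) (k : Coeffs n) :
      jacobiator b f g k = 0 := by
    have : hb.jacobiatorDerivation f g = 0 := MvPolynomial.derivation_ext h
    exact congrArg (fun D : Derivation ℂ (Coeffs n) (Coeffs n) => D k) this
  refine ext f g (fun t => ?_) h
  rw [jacobiator_rotate, jacobiator_rotate]
  refine ext _ f (fun s => ?_) g
  rw [jacobiator_rotate, jacobiator_rotate]
  exact ext _ _ (h3 s t) f

/-! ### The generating functions in the variable `λ` -/

theorem sum_range_two_mul_add_one {M : Type*} [AddCommMonoid M] (g : ℕ → M) (n : ℕ) :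
    ∑ i ∈ Finset.range (2 * n + 1), g i
      = ∑ i ∈ Finset.range (n + 1), g (2 * i) + ∑ i ∈ Finset.range n, g (2 * i + 1) := by
  induction n with
  | zero => simp
  | succ m ih =>
    rw [show 2 * (m + 1) + 1 = 2 * m + 1 + 1 + 1 by ring, Finset.sum_range_succ,
      Finset.sum_range_succ, ih, Finset.sum_range_succ (fun i => g (2 * i)) (m + 1),
      Finset.sum_range_succ (fun i => g (2 * i + 1)) m,
      show 2 * (m + 1) = 2 * m + 1 + 1 by ring]
    abel

theorem at'_polyA (x : ℂ) :
    at' (polyA n α) x = genFun n α .E (x ^ 2) + algebraMap ℂ _ x * genFun n α .O (x ^ 2) := by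
  let g (i : ℕ) : Coeffs n := if h : i < 2 * n + 1 then
    algebraMap ℂ _ x ^ i * MvPolynomial.X (.A ⟨i, h⟩) else 0
  have hA : at' (polyA n α) x
      = algebraMap ℂ _ α * algebraMap ℂ _ x ^ (2 * n + 1) + ∑ i ∈ Finset.range (2 * n + 1), g i := by
    rw [← Fin.sum_univ_eq_sum_range]
    simp only [at', polyA, eval_add, eval_mul, eval_C, eval_pow, eval_X, eval_finsetSum]
    refine congrArg _ (Finset.sum_congr rfl fun i _ => ?_)
    rw [mul_comm]
    change _ = dite _ _ _
    rw [dif_pos i.2]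
  have hE (i) (hi : i ∈ Finset.range (n + 1)) :
      g (2 * i) = (x ^ 2) ^ i • coord n α .E i := by
    have hi : i < Kind.E.size n := Finset.mem_range.1 hi
    have hi' : 2 * i < 2 * n + 1 := by simp only [Kind.size] at hi; omega
    rw [coord, dif_pos hi, Algebra.smul_def, map_pow, map_pow, ← pow_mul]
    exact dif_pos hi'
  have hO (i) (hi : i ∈ Finset.range n) :
      g (2 * i + 1) = algebraMap ℂ _ x * (x ^ 2) ^ i • coord n α .O i := by
    have hi : i < Kind.O.size n := Finset.mem_range.1 hi
    have hi' : 2 * i + 1 < 2 * n + 1 := by simp only [Kind.size] at hi; omega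
    rw [coord, dif_pos hi, Algebra.smul_def, map_pow, map_pow, ← pow_mul, ← mul_assoc,
      ← pow_succ']
    exact dif_pos hi'
  have h2 : coord n α .O n = algebraMap ℂ _ α := by simp [coord, Kind.size, Kind.top]
  rw [hA, sum_range_two_mul_add_one, genFun_eq_sum, genFun_eq_sum, Finset.sum_congr rfl hE,
    Finset.sum_congr rfl hO, Finset.sum_range_succ _ n, Finset.sum_range_succ _ n, h2, mul_add,
    Finset.mul_sum]
  simp only [Algebra.smul_def, map_pow]
  ring

theorem at'_polyB (α x : ℂ) :
    at' (polyB n) x = algebraMap ℂ _ x * genFun n α .B (x ^ 2) := by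
  rw [genFun_eq_sum, Finset.sum_range_succ, ← Fin.sum_univ_eq_sum_range
    (fun i => (x ^ 2) ^ i • coord n α .B i)]
  have h1 (i : Fin n) : coord n α .B i = MvPolynomial.X (.B i) := by simp [coord, Kind.size, Kind.gen]
  have h2 : coord n α .B n = 1 := by simp [coord, Kind.size, Kind.top]
  simp only [h1, h2, at', polyB, eval_add, eval_pow, eval_X, eval_finsetSum, eval_mul, eval_C,
    Algebra.smul_def, mul_add, Finset.mul_sum, map_pow]
  rw [add_comm]
  congr 1
  · exact Finset.sum_congr rfl fun i _ => by ring
  · ring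

theorem at'_polyC (α x : ℂ) :
    at' (polyC n) x = algebraMap ℂ _ x * genFun n α .C (x ^ 2) := by
  rw [genFun_eq_sum, Finset.sum_range_succ, ← Fin.sum_univ_eq_sum_range
    (fun i => (x ^ 2) ^ i • coord n α .C i)]
  have h1 (i : Fin n) : coord n α .C i = MvPolynomial.X (.C i) := by simp [coord, Kind.size, Kind.gen]
  have h2 : coord n α .C n = 0 := by simp [coord, Kind.size, Kind.top]
  simp only [h1, h2, at', polyC, eval_pow, eval_X, eval_finsetSum, eval_mul, eval_C,
    Algebra.smul_def, Finset.mul_sum, map_pow, mul_zero, add_zero]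
  exact Finset.sum_congr rfl fun i _ => by ring

theorem degree_polyA_lt (n : ℕ) (α : ℂ) : (polyA n α).degree < ((2 * n + 2 : ℕ) : WithBot ℕ) := by
  refine degree_le_natDegree.trans_lt (Nat.cast_lt.2 (Nat.lt_succ_of_le ?_))
  refine natDegree_add_le_of_degree_le (natDegree_C_mul_X_pow_le _ _)
    (natDegree_sum_le_of_forall_le _ _ fun i _ => (natDegree_C_mul_X_pow_le _ _).trans ?_)
  omega

theorem degree_X_mul_polyB (n : ℕ) :
    (X * polyB n).Monic ∧ (X * polyB n).degree = ((2 * n + 2 : ℕ) : WithBot ℕ) := by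
  have h : (∑ i : Fin n, C (MvPolynomial.X (R := ℂ) (Gen.B i)) * X ^ (2 * (i : ℕ) + 1)).degree
      < ((2 * n + 1 : ℕ) : WithBot ℕ) := by
    refine (degree_sum_le _ _).trans_lt ((Finset.sup_lt_iff (WithBot.bot_lt_coe _)).2 fun i _ => ?_)
    refine (degree_C_mul_X_pow_le _ _).trans_lt (Nat.cast_lt.2 ?_)
    omega
  have hB : (polyB n).Monic := monic_X_pow_add h
  refine ⟨monic_X.mul hB, ?_⟩
  rw [degree_mul, degree_X, polyB, degree_add_eq_left_of_degree_lt (by rwa [degree_X_pow]),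
    degree_X_pow, add_comm]
  rfl

theorem polyRho_zero (n : ℕ) (α : ℂ) : polyRho n α 0 = 0 := by
  obtain ⟨hm, hd⟩ := degree_X_mul_polyB n
  rw [polyRho, mul_zero, pow_zero, one_mul, divByMonic_eq_zero_iff hm, hd]
  exact degree_polyA_lt n α

/-- As `B` is odd, `λ B(λ)` has no term of degree `2n + 1`, so the two leading coefficients of `λ²
A(λ)` pass unchanged into the quotient. -/
theorem polyRho_one (n : ℕ) (α : ℂ) : polyRho n α 1 =
    C (MvPolynomial.C α) * X + C (MvPolynomial.X (Gen.A (Fin.last (2 * n)))) := by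
  obtain ⟨hm, hd⟩ := degree_X_mul_polyB n
  set q : (Coeffs n)[X] := C (MvPolynomial.C α) * X + C (MvPolynomial.X (Gen.A (Fin.last (2 * n))))
    with hq
  refine (div_modByMonic_unique q
    (∑ i : Fin (2 * n), C (MvPolynomial.X (Gen.A i.castSucc)) * X ^ ((i : ℕ) + 2)
      - ∑ i : Fin n, C (MvPolynomial.X (Gen.B i)) * X ^ (2 * (i : ℕ) + 2) * q) hm ⟨?_, ?_⟩).1
  · rw [polyA, Fin.sum_univ_castSucc, polyB, hq]
    simp only [Fin.val_castSucc, Fin.val_last, mul_add, add_mul, Finset.mul_sum, Finset.sum_mul,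
      Finset.sum_add_distrib, pow_succ, pow_mul, pow_zero, one_mul, mul_one]
    simp only [mul_comm, mul_left_comm, mul_assoc]
    ring
  · rw [hd]
    refine degree_le_natDegree.trans_lt (Nat.cast_lt.2 (Nat.lt_succ_of_le ?_))
    refine (natDegree_sub_le_of_le (m := 2 * n + 1) (n := 2 * n + 1)
      (natDegree_sum_le_of_forall_le _ _ fun i _ => (natDegree_C_mul_X_pow_le _ _).trans ?_)
      (natDegree_sum_le_of_forall_le _ _ fun i _ => (natDegree_mul_le_of_le
        (natDegree_C_mul_X_pow_le _ _) (show q.natDegree ≤ 1 from natDegree_linear_le)).trans ?_)).trans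
      (max_self _).le
    · omega
    · omega

/-! ### Uniqueness from the generating functions in the variable `λ` -/

/-- For `x ≠ 0` each of `E, O, B, C` at `x²` is a combination of the values of `A`, `B` or `C` at
`x` and `-x`. If `x² ≠ y²`, all four sign choices `(±x, ±y)` satisfy the hypotheses. -/
theorem IsSkewBiderivation.eq_of_at' {b b' : Coeffs n →ₗ[ℂ] Coeffs n →ₗ[ℂ] Coeffs n}
    (hb : IsSkewBiderivation b) (hb' : IsSkewBiderivation b')
    (h : ∀ x y : ℂ, x - y ≠ 0 → x + y ≠ 0 →
      b (at' (polyA n α) x) (at' (polyA n α) y) = b' (at' (polyA n α) x) (at' (polyA n α) y) ∧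
      b (at' (polyA n α) x) (at' (polyB n) y) = b' (at' (polyA n α) x) (at' (polyB n) y) ∧
      b (at' (polyA n α) x) (at' (polyC n) y) = b' (at' (polyA n α) x) (at' (polyC n) y) ∧
      b (at' (polyB n) x) (at' (polyB n) y) = b' (at' (polyB n) x) (at' (polyB n) y) ∧
      b (at' (polyB n) x) (at' (polyC n) y) = b' (at' (polyB n) x) (at' (polyC n) y) ∧
      b (at' (polyC n) x) (at' (polyC n) y) = b' (at' (polyC n) x) (at' (polyC n) y)) :
    b = b' := by
  set d := (1 : ℂ) • b + (-1 : ℂ) • b' with hd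
  have hd_skew : IsSkewBiderivation d := hb.smul_add_smul hb' 1 (-1)
  have hd_apply (f g : Coeffs n) : d f g = b f g - b' f g := by
    simp [hd, sub_eq_add_neg]
  suffices d = 0 by
    refine LinearMap.ext fun f => LinearMap.ext fun g => sub_eq_zero.1 ?_
    rw [← hd_apply, this, LinearMap.zero_apply, LinearMap.zero_apply]
  let letter : Kind → (Coeffs n)[X]
    | .E => polyA n α
    | .O => polyA n α
    | .B => polyB n
    | .C => polyC n
  have hletter (X Y : Kind) (x y : ℂ) (h₁ : x - y ≠ 0) (h₂ : x + y ≠ 0) :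
      d (at' (letter X) x) (at' (letter Y) y) = 0 := by
    obtain ⟨hAA, hAB, hAC, hBB, hBC, hCC⟩ := h x y h₁ h₂
    obtain ⟨-, hAB', hAC', -, hBC', -⟩ := h y x (by rwa [← neg_ne_zero, neg_sub]) (by rwa [add_comm])
    rw [hd_apply, sub_eq_zero]
    have skew (f g : Coeffs n) (h : b f g = b' f g) : b g f = b' g f := by
      rw [hb.skew, hb'.skew, h]
    exact match X, Y with
    | .E, .E | .E, .O | .O, .E | .O, .O => hAA
    | .E, .B | .O, .B => hAB
    | .E, .C | .O, .C => hAC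
    | .B, .E | .B, .O => skew _ _ hAB'
    | .C, .E | .C, .O => skew _ _ hAC'
    | .B, .B => hBB
    | .B, .C => hBC
    | .C, .B => skew _ _ hBC'
    | .C, .C => hCC
  have hgen (X : Kind) : ∃ p q : ℂ → ℂ, ∀ x ≠ 0, genFun n α X (x ^ 2)
      = p x • at' (letter X) x + q x • at' (letter X) (-x) := by
    have key (x : ℂ) (hx : x ≠ 0) :
        (algebraMap ℂ (Coeffs n) x⁻¹) * algebraMap ℂ (Coeffs n) x = 1 := by
      rw [← map_mul, inv_mul_cancel₀ hx, map_one]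
    have key2 : (algebraMap ℂ (Coeffs n) 2⁻¹) * 2 = 1 := by
      rw [← map_ofNat (algebraMap ℂ (Coeffs n)) 2, ← map_mul, inv_mul_cancel₀ two_ne_zero, map_one]
    cases X
    · refine ⟨fun _ => 2⁻¹, fun _ => 2⁻¹, fun x hx => ?_⟩
      simp only [letter, at'_polyA, Algebra.smul_def, neg_sq, map_neg]
      linear_combination -genFun n α .E (x ^ 2) * key2
    · refine ⟨fun x => 2⁻¹ * x⁻¹, fun x => -(2⁻¹ * x⁻¹), fun x hx => ?_⟩
      simp only [letter, at'_polyA, Algebra.smul_def, neg_sq, map_neg, map_mul]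
      have := key x hx
      linear_combination -genFun n α .O (x ^ 2) * (key2 * algebraMap ℂ (Coeffs n) x⁻¹
        * algebraMap ℂ (Coeffs n) x + this)
    · refine ⟨fun x => x⁻¹, fun _ => 0, fun x hx => ?_⟩
      simp only [letter, at'_polyB α, Algebra.smul_def, map_zero]
      linear_combination -genFun n α .B (x ^ 2) * key x hx
    · refine ⟨fun x => x⁻¹, fun _ => 0, fun x hx => ?_⟩
      simp only [letter, at'_polyC α, Algebra.smul_def, map_zero]
      linear_combination -genFun n α .C (x ^ 2) * key x hx
  -- The point 0 is excluded because recovering `O`, `B`, `C` divides by `x`.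
  refine IsSkewBiderivation.eq_zero_of_genFun (α := α) hd_skew (Set.finite_singleton 0)
    fun X Y u v hu hv huv => ?_
  obtain ⟨x, rfl⟩ := IsSquare.exists_sq u (IsAlgClosed.exists_pow_nat_eq u two_pos |>.imp
    fun z hz => by rw [← hz, sq])
  obtain ⟨y, rfl⟩ := IsSquare.exists_sq v (IsAlgClosed.exists_pow_nat_eq v two_pos |>.imp
    fun z hz => by rw [← hz, sq])
  obtain ⟨p, q, hX⟩ := hgen X
  obtain ⟨p', q', hY⟩ := hgen Y
  have h₁ : x - y ≠ 0 := fun h => huv (by rw [sub_eq_zero.1 h])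
  have h₂ : x + y ≠ 0 := fun h => huv (by rw [eq_neg_of_add_eq_zero_left h, neg_sq])
  rw [hX x (by rintro rfl; simp at hu), hY y (by rintro rfl; simp at hv)]
  have h₃ : -x - y ≠ 0 := by rwa [← neg_ne_zero, neg_sub, sub_neg_eq_add, add_comm]
  have h₄ : -x + y ≠ 0 := by rwa [← neg_ne_zero, neg_add, neg_neg, ← sub_eq_add_neg]
  simp only [map_add, map_smul, LinearMap.add_apply, LinearMap.smul_apply, hletter X Y x y h₁ h₂,
    hletter X Y (-x) y h₃ h₄, hletter X Y x (-y) (by rwa [sub_neg_eq_add])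
      (by rwa [← sub_eq_add_neg]), hletter X Y (-x) (-y) (by rwa [sub_neg_eq_add])
      (by rwa [← sub_eq_add_neg])]
  simp

/-! ### The relations of the family -/

theorem at'_polyRho {k : ℕ} (hk : k = 0 ∨ k = 1) (x : ℂ) : at' (polyRho n α k) x =
    algebraMap ℂ _ (k : ℂ) * (algebraMap ℂ _ (α * x) + coord n α .E n) := by
  rcases hk with rfl | rfl
  · simp [polyRho_zero, at']
  · have : coord n α .E n = MvPolynomial.X (Gen.A (Fin.last (2 * n))) :=
      dif_pos (show n < Kind.E.size n from n.lt_succ_self)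
    rw [polyRho_one, this]
    simp [at']

set_option maxHeartbeats 1000000 in
theorem PencilRelations.satisfiesFamilyRelations {η : ℂ} {k : ℕ} (hk : k = 0 ∨ k = 1)
    {b : Coeffs n →ₗ[ℂ] Coeffs n →ₗ[ℂ] Coeffs n} (hb : IsSkewBiderivation b)
    (H : IsPencilBracket n α (η * (1 - k)) (η * k) b) : SatisfiesFamilyRelations n η α k b := by
  -- This linear form in `x²`, times `η`, is `c₀ + c₁ u`; both values of `k` are thus treated at
  -- once.
  have hf (x : ℂ) : x ^ (2 * k) = 1 - k + k * x ^ 2 := by rcases hk with rfl | rfl <;> simp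
  have hsq (x y : ℂ) (h₁ : x - y ≠ 0) (h₂ : x + y ≠ 0) : x ^ 2 ≠ y ^ 2 := by
    rw [ne_eq, sq_eq_sq_iff_eq_or_eq_neg, not_or, ← sub_eq_zero, ← add_eq_zero_iff_eq_neg]
    exact ⟨h₁, h₂⟩
  have inv_mul (x : ℂ) (h : x ≠ 0) : algebraMap ℂ (Coeffs n) x⁻¹ * algebraMap ℂ _ x = 1 := by
    rw [← map_mul, inv_mul_cancel₀ h, map_one]
  have inv_sq (x y : ℂ) : (x ^ 2 - y ^ 2)⁻¹ = (x - y)⁻¹ * (x + y)⁻¹ := by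
    rw [← mul_inv, mul_comm, sq_sub_sq]
  have inv_sq_swap (x y : ℂ) : (x ^ 2 - y ^ 2)⁻¹ = -(y ^ 2 - x ^ 2)⁻¹ := by rw [← inv_neg, neg_sub]
  have hr (c : ℂ) (f g : Coeffs n) :
      b f (algebraMap ℂ _ c * g) = algebraMap ℂ _ c * b f g := by
    rw [← Algebra.smul_def, map_smul, Algebra.smul_def]
  have hl (c : ℂ) (f g : Coeffs n) :
      b (algebraMap ℂ _ c * f) g = algebraMap ℂ _ c * b f g := by
    rw [← Algebra.smul_def, map_smul, LinearMap.smul_apply, Algebra.smul_def]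
  have skew (X Y : Kind) (x y : ℂ) : b (genFun n α X x) (genFun n α Y y)
      = -b (genFun n α Y y) (genFun n α X x) := hb.skew _ _
  constructor <;> intro x y h₁ h₂ <;> have hxy := hsq x y h₁ h₂ <;> have hyx := hxy.symm <;>
    have e₁ := inv_mul _ h₁ <;> have e₂ := inv_mul _ h₂
  all_goals
    simp only [at'_polyA, at'_polyB α, at'_polyC α, at'_polyRho hk, Algebra.smul_def, neg_sq, hf,
      map_add, LinearMap.add_apply, hl, hr, skew .O .E, H.EE _ _ hxy, H.OO _ _ hxy, H.BB _ _ hxy,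
      H.EO _ _ hxy, H.EO _ _ hyx, H.EB _ _ hxy, H.OB _ _ hxy, H.EC _ _ hxy, H.OC _ _ hxy,
      H.BC _ _ hxy, H.CC _ _ hxy, div_eq_mul_inv]
    simp only [inv_sq_swap y x, inv_sq, map_add, map_sub, map_mul, map_neg, map_pow, map_ofNat,
      map_one] at e₁ e₂ ⊢
    try grind

/-! ### The reflection equation -/

theorem reflection_rhs_apply (η x y : ℂ) (i j k l : Fin 2) :
    ((rMatrix n η (x - y) * (T₁ n α x * T₂ n α y) - (T₁ n α x * T₂ n α y) * rMatrix n η (x - y))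
      + T₁ n α x * rMatrix n η (x + y) * T₂ n α y
      - T₂ n α y * rMatrix n η (x + y) * T₁ n α x) (i, k) (j, l) =
    (-η / (x - y)) • (T n α x k j * T n α y i l - T n α x i l * T n α y k j)
      + (-η / (x + y)) • ((if k = j then ∑ m, T n α x i m * T n α y m l else 0)
        - if i = l then ∑ m, T n α y k m * T n α x m j else 0) := by
  have hP (A : Matrix (Fin 2 × Fin 2) (Fin 2 × Fin 2) (Coeffs n)) (i k : Fin 2) (q) :
      (permMatrix n * A) (i, k) q = A (k, i) q := by
    fin_cases i <;> fin_cases k <;>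
      simp [Matrix.mul_apply, permMatrix, Fintype.sum_prod_type, Fin.sum_univ_two]
  have hP' (A : Matrix (Fin 2 × Fin 2) (Fin 2 × Fin 2) (Coeffs n)) (j l : Fin 2) (p) :
      (A * permMatrix n) p (j, l) = A p (l, j) := by
    fin_cases j <;> fin_cases l <;>
      simp [Matrix.mul_apply, permMatrix, Fintype.sum_prod_type, Fin.sum_univ_two]
  have h12 (i k j l : Fin 2) :
      (T₁ n α x * T₂ n α y) (i, k) (j, l) = T n α x i j * T n α y k l := by
    rw [T₁, T₂, ← Matrix.mul_kronecker_mul]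
    simp [Matrix.kroneckerMap_apply]
  have h1P2 : (T₁ n α x * permMatrix n * T₂ n α y) (i, k) (j, l)
      = if k = j then ∑ m, T n α x i m * T n α y m l else 0 := by
    rw [Matrix.mul_apply, Fintype.sum_prod_type]
    simp only [hP', T₁, T₂, Matrix.kroneckerMap_apply, Fin.sum_univ_two]
    fin_cases k <;> fin_cases j <;> simp [Matrix.one_apply]
  have h2P1 : (T₂ n α y * permMatrix n * T₁ n α x) (i, k) (j, l)
      = if i = l then ∑ m, T n α y k m * T n α x m j else 0 := by
    rw [Matrix.mul_apply, Fintype.sum_prod_type]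
    simp only [hP', T₁, T₂, Matrix.kroneckerMap_apply, Fin.sum_univ_two]
    fin_cases i <;> fin_cases l <;> simp [Matrix.one_apply]
  simp only [rMatrix, Matrix.smul_mul, Matrix.mul_smul, Matrix.add_apply, Matrix.sub_apply,
    Matrix.smul_apply, hP, hP', h12, h1P2, h2P1, smul_sub]
  abel

-- With `c₁ = 0` all correction terms disappear. The sign of `η` compensates for the one in
-- `rMatrix`.
set_option maxHeartbeats 2000000 in
theorem PencilRelations.satisfiesReflectionEquation {η : ℂ}
    {b : Coeffs n →ₗ[ℂ] Coeffs n →ₗ[ℂ] Coeffs n} (hb : IsSkewBiderivation b)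
    (H : IsPencilBracket n α η 0 b) : SatisfiesReflectionEquation n (-η) α b := by
  have hsq (x y : ℂ) (h₁ : x - y ≠ 0) (h₂ : x + y ≠ 0) : x ^ 2 ≠ y ^ 2 := by
    rw [ne_eq, sq_eq_sq_iff_eq_or_eq_neg, not_or, ← sub_eq_zero, ← add_eq_zero_iff_eq_neg]
    exact ⟨h₁, h₂⟩
  have inv_mul (x : ℂ) (h : x ≠ 0) : algebraMap ℂ (Coeffs n) x⁻¹ * algebraMap ℂ _ x = 1 := by
    rw [← map_mul, inv_mul_cancel₀ h, map_one]
  have inv_sq (x y : ℂ) : (x ^ 2 - y ^ 2)⁻¹ = (x - y)⁻¹ * (x + y)⁻¹ := by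
    rw [← mul_inv, mul_comm, sq_sub_sq]
  have inv_sq_swap (x y : ℂ) : (x ^ 2 - y ^ 2)⁻¹ = -(y ^ 2 - x ^ 2)⁻¹ := by rw [← inv_neg, neg_sub]
  have hr (c : ℂ) (f g : Coeffs n) :
      b f (algebraMap ℂ _ c * g) = algebraMap ℂ _ c * b f g := by
    rw [← Algebra.smul_def, map_smul, Algebra.smul_def]
  have hl (c : ℂ) (f g : Coeffs n) :
      b (algebraMap ℂ _ c * f) g = algebraMap ℂ _ c * b f g := by
    rw [← Algebra.smul_def, map_smul, LinearMap.smul_apply, Algebra.smul_def]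
  have skew (X Y : Kind) (x y : ℂ) : b (genFun n α X x) (genFun n α Y y)
      = -b (genFun n α Y y) (genFun n α X x) := hb.skew _ _
  intro x y h₁ h₂
  have hxy := hsq x y h₁ h₂
  have hyx := hxy.symm
  have e₁ := inv_mul _ h₁
  have e₂ := inv_mul _ h₂
  ext ⟨i, k⟩ ⟨j, l⟩
  rw [reflection_rhs_apply]
  simp only [bracketMatrix, Matrix.of_apply, Fin.sum_univ_two, T]
  fin_cases i <;> fin_cases j <;> fin_cases k <;> fin_cases l
  all_goals
    simp only [Fin.zero_eta, Fin.mk_one, Fin.isValue, Matrix.cons_val_zero,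
      Matrix.cons_val_one, Matrix.cons_val', Matrix.cons_val_fin_one, zero_ne_one, one_ne_zero,
      if_true, if_false, neg_neg]
    simp only [at'_polyA, at'_polyB α, at'_polyC α, Algebra.smul_def, neg_sq,
      map_add, LinearMap.add_apply, hl, hr, skew .O .E, skew .B .E, skew .C .E, skew .B .O,
      skew .C .O, skew .C .B, H.EE _ _ hxy, H.OO _ _ hxy, H.BB _ _ hxy,
      H.EO _ _ hxy, H.EO _ _ hyx, H.EB _ _ hxy, H.EB _ _ hyx, H.OB _ _ hxy, H.OB _ _ hyx,
      H.EC _ _ hxy, H.EC _ _ hyx, H.OC _ _ hxy, H.OC _ _ hyx, H.BC _ _ hxy, H.BC _ _ hyx,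
      H.CC _ _ hxy, div_eq_mul_inv]
    simp only [inv_sq_swap y x, inv_sq, map_add, map_sub, map_mul, map_neg, map_pow, map_ofNat,
      map_zero] at e₁ e₂ ⊢
    grind

theorem SatisfiesReflectionEquation.eq {η : ℂ} {b b' : Coeffs n →ₗ[ℂ] Coeffs n →ₗ[ℂ] Coeffs n}
    (hb : IsSkewBiderivation b) (hb' : IsSkewBiderivation b')
    (h : SatisfiesReflectionEquation n η α b) (h' : SatisfiesReflectionEquation n η α b') :
    b = b' := by
  refine IsSkewBiderivation.eq_of_at' (α := α) hb hb' fun x y h₁ h₂ => ?_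
  -- The arguments are ordered as the row pair `(i, k)`, then the column pair `(j, l)`.
  have key (i k j l : Fin 2) : b (T n α x i j) (T n α y k l) = b' (T n α x i j) (T n α y k l) :=
    congrFun (congrFun ((h x y h₁ h₂).trans (h' x y h₁ h₂).symm) (i, k)) (j, l)
  exact ⟨key 0 0 0 0, key 0 0 0 1, key 0 1 0 0, key 0 0 1 1, key 0 1 1 0, key 1 1 0 0⟩

theorem SatisfiesFamilyRelations.eq {η : ℂ} {k : ℕ}
    {b b' : Coeffs n →ₗ[ℂ] Coeffs n →ₗ[ℂ] Coeffs n}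
    (hb : IsSkewBiderivation b) (hb' : IsSkewBiderivation b')
    (h : SatisfiesFamilyRelations n η α k b) (h' : SatisfiesFamilyRelations n η α k b') :
    b = b' :=
  IsSkewBiderivation.eq_of_at' (α := α) hb hb' fun x y h₁ h₂ =>
    ⟨(h.AA x y h₁ h₂).trans (h'.AA x y h₁ h₂).symm, (h.AB x y h₁ h₂).trans (h'.AB x y h₁ h₂).symm,
      (h.AC x y h₁ h₂).trans (h'.AC x y h₁ h₂).symm, (h.BB x y h₁ h₂).trans (h'.BB x y h₁ h₂).symm,
      (h.BC x y h₁ h₂).trans (h'.BC x y h₁ h₂).symm, (h.CC x y h₁ h₂).trans (h'.CC x y h₁ h₂).symm⟩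

end ReflectionAlgebra

end

/-! ### The two brackets as members of the pencil -/

open Polynomial ReflectionAlgebra in
/-- For `k = 0, 1` the relations of the family define one and only one bracket `P k` on the
algebra of functions of the coefficients of `T(λ)`; `P 0`, `P 1` are compatible Poisson brackets,
and `P 0` is the bracket of the rational reflection equation algebra with
`r(λ) = (η / λ) Π` (that is, with `-η` in place of `η` in `r(λ) = (-η / λ) Π`). -/
theorem proposition1 (n : ℕ) (η α : ℂ) :
    polyRho n α 0 = 0 ∧
    polyRho n α 1 =
      C (MvPolynomial.C α) * X + C (MvPolynomial.X (Gen.A (Fin.last (2 * n)))) ∧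
    ∃ P : Fin 2 → (Coeffs n →ₗ[ℂ] Coeffs n →ₗ[ℂ] Coeffs n),
      (∀ (k : Fin 2) (b : Coeffs n →ₗ[ℂ] Coeffs n →ₗ[ℂ] Coeffs n),
        (IsSkewBiderivation b ∧ SatisfiesFamilyRelations n η α (k : ℕ) b) ↔ b = P k) ∧
      (∀ k : Fin 2, IsPoissonBracket (P k)) ∧
      (∀ b : Coeffs n →ₗ[ℂ] Coeffs n →ₗ[ℂ] Coeffs n,
        (IsSkewBiderivation b ∧ SatisfiesReflectionEquation n (-η) α b) ↔ b = P 0) ∧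
      AreCompatible (P 0) (P 1) := by
  refine ⟨polyRho_zero n α, polyRho_one n α, ?_⟩
  choose P hP H using fun k : Fin 2 =>
    exists_isPencilBracket n α (η * (1 - (k : ℕ))) (η * (k : ℕ))
  have hk (k : Fin 2) : (k : ℕ) = 0 ∨ (k : ℕ) = 1 := by omega
  refine ⟨P, fun k b => ⟨fun h => ?_, ?_⟩, fun k => (H k).isPoissonBracket (hP k),
    fun b => ⟨fun h => ?_, ?_⟩, fun c c' => ?_⟩
  · exact h.2.eq h.1 (hP k) ((H k).satisfiesFamilyRelations (hk k) (hP k))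
  · rintro rfl
    exact ⟨hP k, (H k).satisfiesFamilyRelations (hk k) (hP k)⟩
  · have H0 : IsPencilBracket n α η 0 (P 0) := by simpa using H 0
    exact h.2.eq h.1 (hP 0) (H0.satisfiesReflectionEquation (hP 0))
  · rintro rfl
    have H0 : IsPencilBracket n α η 0 (P 0) := by simpa using H 0
    exact ⟨hP 0, H0.satisfiesReflectionEquation (hP 0)⟩
  · exact ((H 0).smul_add_smul (H 1) c c').isPoissonBracket ((hP 0).smul_add_smul (hP 1) c c')
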